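/- Let $X$ be an arbitrary topological space (possibly empty), $I=[0,1]$, and let $X_+=X\sqcup\{\ast\}$ be $X$ with a disjoint basepoint added. Let $$\Sigma(X_+)=\frac{X_+\times I}{X\times\{0,1\}\cup\{\ast\}\times I}$$ be its reduced suspension, with the quotient topology and with basepoint $x_0$ the image of the collapsed subspace, and write $x\wedge t$ for the image of $(x,t)\in X\times I$. For $x\in X$ let $u_x$ be the James loop $u_x(t)=x\wedge t$ in $\Sigma(X_+)$ based at $x_0$, let $u_x^{1}=u_x$, and let $u_x^{-1}$ be the reversed loop. Let $\pi_0(X)$ be the set of path components of $X$ and let $\pi_1(\Sigma(X_+))=\pi_1(\Sigma(X_+),x_0)$ with the product $[\alpha][\beta]=[\alpha\ast\beta]$, where $\alpha\ast\beta$ is $\alpha$ followed by $\beta$. The class $[u_x]\in\pi_1(\Sigma(X_+))$ depends only on the path component of $x$ in $X$. Hence there is a unique group homomorphism $h_X:F(\pi_0(X))\to\pi_1(\Sigma(X_+))$ on the free group on the set $\pi_0(X)$ that sends the path component of $x$ to $[u_x]$ for every $x\in X$. For all $n\ge 0$, $x_1,\dots,x_n\in X$ with path components $P_1,\dots,P_n$,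 and $\epsilon_1,\dots,\epsilon_n\in\{1,-1\}$ it satisfies $$h_X(P_1^{\epsilon_1}\cdots P_n^{\epsilon_n})=[u_{x_1}^{\epsilon_1}\ast\cdots\ast u_{x_n}^{\epsilon_n}].$$ Theorem. $h_X:F(\pi_0(X))\to\pi_1(\Sigma(X_+))$ is an isomorphism of groups. In other words, $\pi_1(\Sigma(X_+))$ is free on the classes $[u_x]$, one for each path component of $X$. -/

import Mathlib

open scoped unitInterval

/-- The space `X₊ = X ⊔ {∗}`: the disjoint union of `X` with a one-point space. -/
abbrev AddDisjointPoint (X : Type*) : Type _ := X ⊕ Unit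

/-- The subspace `Y × {0,1} ∪ {y₀} × I` of `Y × I`. -/
def suspensionCollapsed {Y : Type*} (y₀ : Y) : Set (Y × I) :=
  {p | p.2 = 0 ∨ p.2 = 1 ∨ p.1 = y₀}

/-- The equivalence relation on `Y × I` that identifies all the points of
`Y × {0,1} ∪ {y₀} × I` with each other and nothing else. -/
def suspensionSetoid {Y : Type*} (y₀ : Y) : Setoid (Y × I) where
  r p q := p = q ∨ (p ∈ suspensionCollapsed y₀ ∧ q ∈ suspensionCollapsed y₀)
  iseqv :=
    { refl := fun _ => Or.inl rfl
      symm := by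
        rintro p q (h | ⟨hp, hq⟩)
        · exact Or.inl h.symm
        · exact Or.inr ⟨hq, hp⟩
      trans := by
        rintro p q r (rfl | ⟨hp, hq⟩) (rfl | ⟨hq', hr⟩)
        · exact Or.inl rfl
        · exact Or.inr ⟨hq', hr⟩
        · exact Or.inr ⟨hp, hq⟩
        · exact Or.inr ⟨hp, hr⟩ }

/-- The reduced suspension `Σ(Y, y₀) = (Y × I) / (Y × {0,1} ∪ {y₀} × I)`. -/
def ReducedSuspension (Y : Type*) (y₀ : Y) : Type _ :=
  Quotient (suspensionSetoid y₀)

/-- The quotient topology. -/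
instance ReducedSuspension.instTopologicalSpace (Y : Type*) [TopologicalSpace Y] (y₀ : Y) :
    TopologicalSpace (ReducedSuspension Y y₀) :=
  inferInstanceAs (TopologicalSpace (Quotient (suspensionSetoid y₀)))

/-- The space `Σ(X₊)`. -/
abbrev SuspensionPlus (X : Type*) : Type _ :=
  ReducedSuspension (AddDisjointPoint X) (Sum.inr ())

namespace SuspensionPlus

/-- The canonical basepoint `x₀` of `Σ(X₊)`, the image of the collapsed subspace. -/
def base (X : Type*) : SuspensionPlus X :=
  Quotient.mk (suspensionSetoid _) (Sum.inr (), 0)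

/-- The point `x ∧ t` of `Σ(X₊)`: the image of `(x, t) ∈ X × I`. -/
def wedge {X : Type*} (x : X) (t : I) : SuspensionPlus X :=
  Quotient.mk (suspensionSetoid _) (Sum.inl x, t)

theorem wedge_zero {X : Type*} (x : X) : wedge x 0 = base X :=
  Quotient.sound (s := suspensionSetoid _) (Or.inr ⟨Or.inl rfl, Or.inl rfl⟩)

theorem wedge_one {X : Type*} (x : X) : wedge x 1 = base X :=
  Quotient.sound (s := suspensionSetoid _) (Or.inr ⟨Or.inr (Or.inl rfl), Or.inl rfl⟩)

theorem continuous_wedge {X : Type*} [TopologicalSpace X] :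
    Continuous (fun p : X × I => wedge p.1 p.2) :=
  (continuous_quotient_mk' (s := suspensionSetoid (Sum.inr () : AddDisjointPoint X))).comp
    ((continuous_inl.comp continuous_fst).prodMk continuous_snd)

end SuspensionPlus

/-- The James loop `u_x : I → Σ(X₊)`, `u_x(t) = x ∧ t`. -/
def jamesLoop {X : Type*} [TopologicalSpace X] (x : X) :
    Path (SuspensionPlus.base X) (SuspensionPlus.base X) where
  toFun t := SuspensionPlus.wedge x t
  continuous_toFun :=
    SuspensionPlus.continuous_wedge.comp (continuous_const.prodMk continuous_id)
  source' := SuspensionPlus.wedge_zero x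
  target' := SuspensionPlus.wedge_one x

/-- A path from `x` to `y` in `X` induces a homotopy from `u_x` to `u_y`. -/
theorem jamesLoop_homotopic {X : Type*} [TopologicalSpace X] {x y : X} (h : Joined x y) :
    (jamesLoop x).Homotopic (jamesLoop y) := by
  obtain ⟨p⟩ := h
  refine ⟨{ toFun := fun st => SuspensionPlus.wedge (p st.1) st.2
            continuous_toFun := SuspensionPlus.continuous_wedge.comp
              ((p.continuous.comp continuous_fst).prodMk continuous_snd)
            map_zero_left := fun t => by simp [jamesLoop]
            map_one_left := fun t => by simp [jamesLoop]
            prop' := ?_ }⟩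
  rintro s t (rfl | rfl)
  · exact (SuspensionPlus.wedge_zero _).trans (SuspensionPlus.wedge_zero _).symm
  · exact (SuspensionPlus.wedge_one _).trans (SuspensionPlus.wedge_one _).symm

/-- The fundamental group `π₁(Y, y)` with the product `[α][β] = [α ∗ β]`, where `α ∗ β` is `α`
followed by `β`. Mathlib's `FundamentalGroup` multiplies in the opposite order, so this is its
opposite group. -/
abbrev PiOne (Y : Type*) [TopologicalSpace Y] (y : Y) : Type _ :=
  (FundamentalGroup Y y)ᵐᵒᵖ

/-- The class `[γ] ∈ π₁(Y, y)` of a loop `γ`. -/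
def loopClass {Y : Type*} [TopologicalSpace Y] {y : Y} (γ : Path y y) : PiOne Y y :=
  MulOpposite.op (FundamentalGroup.fromPath (Path.Homotopic.Quotient.mk γ))

theorem loopClass_eq_iff {Y : Type*} [TopologicalSpace Y] {y : Y} {α β : Path y y} :
    loopClass α = loopClass β ↔ α.Homotopic β :=
  MulOpposite.op_inj.trans Path.Homotopic.Quotient.eq

theorem loopClass_trans {Y : Type*} [TopologicalSpace Y] {y : Y} (α β : Path y y) :
    loopClass (α.trans β) = loopClass α * loopClass β :=
  rfl

/-- The map `u_∗ : π₀(X) → π₁(Σ(X₊))` sending the path component of `x` to `[u_x]`. -/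
def jamesClass (X : Type*) [TopologicalSpace X] :
    ZerothHomotopy X → PiOne (SuspensionPlus X) (SuspensionPlus.base X) :=
  Quotient.lift (s := pathSetoid X) (fun x => loopClass (jamesLoop x))
    (fun _ _ h => loopClass_eq_iff.mpr (jamesLoop_homotopic h))

/-- The homomorphism `h_X : F(π₀(X)) → π₁(Σ(X₊))` induced by `u_∗`. -/
noncomputable def jamesHom (X : Type*) [TopologicalSpace X] :
    FreeGroup (ZerothHomotopy X) →* PiOne (SuspensionPlus X) (SuspensionPlus.base X) :=
  FreeGroup.lift (jamesClass X)

/-- The concatenation `u_{x₁}^{ε₁} ∗ ⋯ ∗ u_{xₙ}^{εₙ}` of James loops and reversed James loops;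
`true` stands for `ε = 1` and `false` for `ε = -1`. The empty word gives the constant loop. -/
noncomputable def jamesWord {X : Type*} [TopologicalSpace X] :
    List (X × Bool) → Path (SuspensionPlus.base X) (SuspensionPlus.base X)
  | [] => Path.refl _
  | (x, true) :: w => (jamesLoop x).trans (jamesWord w)
  | (x, false) :: w => (jamesLoop x).symm.trans (jamesWord w)

/-! Injectivity comes from a covering, surjectivity from a subdivision argument that needs no van
Kampen theorem.

Let `G` be a discrete group and `φ` a map from π₀(X) to `G`. Cover Σ(X₊) by `offMiddle X` (near the
basepoint) and the open cylinder X × (0,1). They overlap in the two pieces t < 1/3 and t > 2/3 of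
the cylinder. Gluing trivial `G`-bundles by the identity on the first piece and by right
multiplication by `φ [x]` on the second gives a covering in which `u_x` lifts to paths from `g` to
`g * φ [x]` (`exists_lift_jamesLoop`). For arbitrary `X` the map x ↦ [x] need not be locally
constant, so the covering is built over `Delta X`, a locally path-connected retopologization with
the same paths and homotopies. A null-homotopic word must lift to a closed path
(`lift_eq_one_of_homotopic_refl`); with `G` the free group and `φ` the inclusion of generators, the
word is trivial.

For surjectivity, a loop may meet the basepoint wildly, and its `X`-coordinate has no meaning there.
A homotopy stretching the cylinder coordinate collapses `offMiddle X` to the basepoint. A Lebesgue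
subdivision then cuts the stretched loop into pieces that are constant or have continuous
coordinates `(ξ, τ)`. Induction over the pieces keeps the invariant `ClosesUp`; the cylinder case
slides the closing arc along the piece (`ClosesUp.trans_cylinder`). -/

open Set Topology

/-! ### Coverings glued from discrete group-valued cocycles -/

/-- The bundle with fibre a discrete group `G` whose transition functions are right
multiplications by `(a i b)⁻¹ * a j b`. -/
def cocycleCore {ι B G : Type*} [TopologicalSpace B] [Group G] [TopologicalSpace G]
    [DiscreteTopology G] (s : ι → Set B) (hs : ∀ i, IsOpen (s i)) (idx : B → ι)
    (hidx : ∀ b, b ∈ s (idx b)) (a : ι → B → G)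
    (ha : ∀ i j, ContinuousOn (fun b => (a i b)⁻¹ * a j b) (s i ∩ s j)) :
    FiberBundleCore ι B G where
  baseSet := s
  isOpen_baseSet := hs
  indexAt := idx
  mem_baseSet_at := hidx
  coordChange i j b g := g * ((a i b)⁻¹ * a j b)
  coordChange_self i b _ g := by simp
  continuousOn_coordChange i j := by
    have h : Continuous fun p : G × G => p.1 * p.2 := continuous_of_discreteTopology
    exact h.comp_continuousOn (continuousOn_snd.prodMk
      ((ha i j).comp continuousOn_fst fun p hp => hp.1))
  -- The transition functions form a coboundary, so the cocycle identity is formal, though no single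
  -- `a i` need be continuous.
  coordChange_comp i j k b _ g := by group

/-- A map into the total space is continuous if it is so in every chart. -/
theorem FiberBundleCore.continuous_of_charts {ι B F Y : Type*} [TopologicalSpace B]
    [TopologicalSpace F] [TopologicalSpace Y] (Z : FiberBundleCore ι B F) {f : Y → B}
    (hf : Continuous f) (v : Y → F)
    (hv : ∀ i, ContinuousOn (fun y => Z.coordChange (Z.indexAt (f y)) i (f y) (v y))
      (f ⁻¹' Z.baseSet i)) :
    Continuous (fun y => (⟨f y, v y⟩ : Z.TotalSpace)) := by
  refine continuous_iff_continuousAt.2 fun y => ?_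
  have A : f ⁻¹' Z.baseSet (Z.indexAt (f y)) ∈ 𝓝 y :=
    ((Z.isOpen_baseSet _).preimage hf).mem_nhds (Z.mem_baseSet_at _)
  refine ((Z.localTriv
    (Z.indexAt (f y))).toOpenPartialHomeomorph.continuousAt_iff_continuousAt_comp_left ?_).2 ?_
  · exact A
  · exact hf.continuousAt.prodMk ((hv _).continuousAt A)

/-! ### The suspension away from its basepoint -/

/-- On a locally path-connected space, the path component of the value of a continuous map is
locally constant. -/
theorem ZerothHomotopy.isLocallyConstant_mk_comp {Y X : Type*} [TopologicalSpace Y]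
    [TopologicalSpace X] [LocallyPathConnectedSpace Y] {f : Y → X} (hf : Continuous f) :
    IsLocallyConstant fun y => ZerothHomotopy.mk (f y) := by
  refine (IsLocallyConstant.iff_eventually_eq _).2 fun y => ?_
  filter_upwards [(IsOpen.pathComponent y).mem_nhds (mem_pathComponent_self y)] with z hz
  exact (ZerothHomotopy.sound ((Joined.somePath hz).map hf)).symm

namespace SuspensionPlus

variable {X : Type*}

theorem wedge_eq_wedge {x y : X} {s t : I} :
    wedge x s = wedge y t ↔ (x = y ∧ s = t) ∨ ((s = 0 ∨ s = 1) ∧ (t = 0 ∨ t = 1)) := by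
  refine (Quotient.eq (r := suspensionSetoid _)).trans ?_
  change (_ ∨ (_ ∈ suspensionCollapsed _ ∧ _ ∈ suspensionCollapsed _)) ↔ _
  simp [suspensionCollapsed]

theorem wedge_eq_base {x : X} {t : I} : wedge x t = base X ↔ t = 0 ∨ t = 1 := by
  rw [← wedge_zero x, wedge_eq_wedge]
  simp only [true_or, and_true, true_and]
  tauto

theorem mk_inr (t : I) :
    (Quotient.mk (suspensionSetoid _) (Sum.inr (), t) : SuspensionPlus X) = base X :=
  Quotient.sound (s := suspensionSetoid _) (Or.inr ⟨Or.inr (Or.inr rfl), Or.inl rfl⟩)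

theorem eq_base_or_wedge (b : SuspensionPlus X) : b = base X ∨ ∃ x t, b = wedge x t := by
  obtain ⟨⟨x | ⟨⟩, t⟩, rfl⟩ := Quotient.exists_rep b
  · exact Or.inr ⟨x, t, rfl⟩
  · exact Or.inl (mk_inr t)

variable [TopologicalSpace X]

/-- The summand {∗} × I is open in X₊ × I and is sent to one point, so it imposes no condition on
`s`. -/
theorem isOpen_iff {s : Set (SuspensionPlus X)} :
    IsOpen s ↔ IsOpen ((fun p : X × I => wedge p.1 p.2) ⁻¹' s) := by
  refine ⟨fun h => h.preimage continuous_wedge, fun h => ?_⟩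
  refine (isQuotientMap_quotient_mk' (s := suspensionSetoid _)).isOpen_preimage.1
    (isOpen_iff_mem_nhds.2 ?_)
  rintro ⟨x | ⟨⟩, t⟩ hp
  · have hop : IsOpenMap (Prod.map Sum.inl id : X × I → AddDisjointPoint X × I) :=
      isOpenMap_inl.prodMap IsOpenMap.id
    refine Filter.mem_of_superset ((hop _ h).mem_nhds ⟨(x, t), hp, rfl⟩) ?_
    rintro _ ⟨q, hq, rfl⟩
    exact hq
  · have hop : IsOpen (range (Sum.inr : Unit → AddDisjointPoint X) ×ˢ (univ : Set I)) :=
      isOpen_range_inr.prod isOpen_univ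
    refine Filter.mem_of_superset (hop.mem_nhds ⟨⟨(), rfl⟩, mem_univ _⟩) ?_
    rintro ⟨_, t'⟩ ⟨⟨⟨⟩, rfl⟩, -⟩
    have hp' : (Quotient.mk (suspensionSetoid _) (Sum.inr (), t) : SuspensionPlus X) ∈ s := hp
    rw [mk_inr, ← mk_inr t'] at hp'
    exact hp'

theorem isQuotientMap_wedge [Nonempty X] : IsQuotientMap (fun p : X × I => wedge p.1 p.2) := by
  refine ⟨isCoinducing_iff.2 fun s => isOpen_iff.symm, fun b => ?_⟩
  obtain rfl | ⟨x, t, rfl⟩ := eq_base_or_wedge b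
  · exact ⟨(Classical.arbitrary X, 0), wedge_zero _⟩
  · exact ⟨(x, t), rfl⟩

/-- The cylinder `X × (0,1)` embeds as an open subspace of `Σ(X₊)`. -/
theorem isOpenEmbedding_wedge :
    IsOpenEmbedding (fun p : X × Ioo (0 : I) 1 => wedge p.1 p.2.1) := by
  have hc : Continuous (Prod.map id Subtype.val : X × Ioo (0 : I) 1 → X × I) := by fun_prop
  refine .of_continuous_injective_isOpenMap (continuous_wedge.comp hc) ?_ fun s hs => ?_
  · rintro ⟨x, t, ht⟩ ⟨y, t', ht'⟩ h
    have := wedge_eq_wedge.1 h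
    simp only [ht.1.ne', ht.2.ne, or_self, false_and, or_false] at this
    simp [this]
  · rw [isOpen_iff]
    have hop : IsOpenMap (Prod.map id Subtype.val : X × Ioo (0 : I) 1 → X × I) :=
      IsOpenMap.id.prodMap isOpen_Ioo.isOpenMap_subtype_val
    convert hop s hs using 1
    ext ⟨x, t⟩
    simp only [mem_preimage, mem_image, Prod.exists, Prod.map_apply, id_eq, Prod.mk.injEq]
    constructor
    · rintro ⟨y, t', h, h'⟩
      have := wedge_eq_wedge.1 h'
      simp only [t'.2.1.ne', t'.2.2.ne, or_self, false_and, or_false] at this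
      exact ⟨y, t', h, this⟩
    · rintro ⟨y, t', h, rfl, rfl⟩
      exact ⟨y, t', h, rfl⟩

theorem range_wedge_Ioo {X : Type*} :
    range (fun p : X × Ioo (0 : I) 1 => wedge p.1 p.2.1) = {base X}ᶜ := by
  ext b
  simp only [mem_range, Prod.exists, mem_compl_iff, mem_singleton_iff]
  constructor
  · rintro ⟨x, t, rfl⟩
    simp [wedge_eq_base, t.2.1.ne', t.2.2.ne]
  · intro h
    obtain rfl | ⟨x, t, rfl⟩ := eq_base_or_wedge b
    · exact (h rfl).elim
    · rw [wedge_eq_base, not_or] at h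
      exact ⟨x, ⟨t, unitInterval.pos_iff_ne_zero.2 h.1, unitInterval.lt_one_iff_ne_one.2 h.2⟩, rfl⟩

theorem isOpen_compl_base : IsOpen ({base X}ᶜ : Set (SuspensionPlus X)) :=
  range_wedge_Ioo (X := X) ▸ (isOpenEmbedding_wedge (X := X)).isOpen_range

/-- A map into the complement of the basepoint has continuous cylinder coordinates. -/
theorem exists_coordinates {Y : Type*} [TopologicalSpace Y] {f : Y → SuspensionPlus X}
    (hf : Continuous f) (hb : ∀ y, f y ≠ base X) :
    ∃ (ξ : C(Y, X)) (τ : C(Y, I)), (∀ y, 0 < τ y ∧ τ y < 1) ∧ ∀ y, f y = wedge (ξ y) (τ y) := by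
  let e := isOpenEmbedding_wedge (X := X).isEmbedding.toHomeomorph
  have hr (y : Y) : f y ∈ range (fun p : X × Ioo (0 : I) 1 => wedge p.1 p.2.1) := by
    rw [range_wedge_Ioo]; exact hb y
  let g : C(Y, X × Ioo (0 : I) 1) :=
    ⟨fun y => e.symm ⟨f y, hr y⟩, e.symm.continuous.comp (hf.subtype_mk hr)⟩
  refine ⟨⟨fun y => (g y).1, by fun_prop⟩, ⟨fun y => (g y).2.1, by fun_prop⟩,
    fun y => (g y).2.2, fun y => ?_⟩
  exact (congrArg Subtype.val (e.apply_symm_apply ⟨f y, hr y⟩)).symm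

/-- The complement of the middle band `X × [1/3,2/3]`. -/
def offMiddle (X : Type*) : Set (SuspensionPlus X) :=
  {b | ∀ (x : X) (t : I), b = wedge x t → (t : ℝ) < 1 / 3 ∨ 2 / 3 < (t : ℝ)}

theorem wedge_mem_offMiddle {X : Type*} {x : X} {t : I} :
    wedge x t ∈ offMiddle X ↔ (t : ℝ) < 1 / 3 ∨ 2 / 3 < (t : ℝ) := by
  refine ⟨fun h => h x t rfl, fun h y s hs => ?_⟩
  obtain ⟨-, rfl⟩ | ⟨-, rfl | rfl⟩ := wedge_eq_wedge.1 hs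
  · exact h
  all_goals norm_num

theorem base_mem_offMiddle {X : Type*} : base X ∈ offMiddle X := by
  intro x t h
  obtain rfl | rfl := wedge_eq_base.1 h.symm <;> norm_num

theorem isOpen_offMiddle : IsOpen (offMiddle X) := by
  rw [isOpen_iff]
  have : (fun p : X × I => wedge p.1 p.2) ⁻¹' offMiddle X =
      {p | (p.2 : ℝ) < 1 / 3} ∪ {p | 2 / 3 < (p.2 : ℝ)} := by
    ext p; exact wedge_mem_offMiddle
  rw [this]
  exact (isOpen_lt (by fun_prop) continuous_const).union
    (isOpen_lt continuous_const (by fun_prop))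

/-- The transition function of the coverings of `Σ(X₊)`: on the part `X × (1/2,1)` it takes the
value prescribed on the path component, elsewhere it is trivial. -/
noncomputable def transition {G : Type*} [One G] (φ : ZerothHomotopy X → G) :
    SuspensionPlus X → G :=
  Quotient.lift (fun p : AddDisjointPoint X × I =>
      p.1.elim (fun x => if 1 / 2 < (p.2 : ℝ) ∧ (p.2 : ℝ) < 1 then φ (.mk x) else 1) fun _ => 1) (by
    have key : ∀ p ∈ suspensionCollapsed (Sum.inr () : AddDisjointPoint X),
        p.1.elim (fun x => if 1 / 2 < (p.2 : ℝ) ∧ (p.2 : ℝ) < 1 then φ (.mk x) else 1)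
          (fun _ => 1) = 1 := by
      rintro ⟨x | x, t⟩ (h | h | h)
      all_goals simp_all
    rintro p q (rfl | ⟨hp, hq⟩)
    · rfl
    · exact (key p hp).trans (key q hq).symm)

theorem transition_wedge {G : Type*} [One G] (φ : ZerothHomotopy X → G) (x : X) (t : I) :
    transition φ (wedge x t) = if 1 / 2 < (t : ℝ) ∧ (t : ℝ) < 1 then φ (.mk x) else 1 := rfl

/-- The jump at t = 1/2 lies in the excluded middle band. Below it the transition is constantly 1;
above it, it is `φ` of the path component of `ξ`, locally constant because `Y` is locally
path-connected. -/
theorem continuousAt_transition_comp {Y G : Type*} [TopologicalSpace Y]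
    [LocallyPathConnectedSpace Y] [One G] [TopologicalSpace G] (φ : ZerothHomotopy X → G)
    {f : Y → SuspensionPlus X} (hf : Continuous f) {y : Y} (hy : f y ∈ offMiddle X)
    (hy' : f y ≠ base X) : ContinuousAt (transition φ ∘ f) y := by
  have hO : IsOpen (f ⁻¹' {base X}ᶜ) := isOpen_compl_base.preimage hf
  have := hO.locallyPathConnectedSpace
  obtain ⟨ξ, τ, hτ, hξ⟩ := exists_coordinates (hf.comp continuous_subtype_val)
    (fun z : f ⁻¹' {base X}ᶜ => z.2)
  rw [← hO.isOpenEmbedding_subtypeVal.continuousAt_iff (x := ⟨y, hy'⟩)]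
  have hloc : Continuous fun z => φ (ZerothHomotopy.mk (ξ z)) := by
    exact ((ZerothHomotopy.isLocallyConstant_mk_comp ξ.continuous).comp φ).continuous
  have h2 : Continuous fun z => (τ z : ℝ) := by fun_prop
  rcases hy _ _ (hξ ⟨y, hy'⟩) with h | h
  · refine (continuousAt_const (y := (1 : G))).congr ?_
    filter_upwards [(isOpen_lt h2 continuous_const).mem_nhds h] with z hz
    have := hξ z
    simp only [Function.comp_apply] at this ⊢
    rw [this, transition_wedge, if_neg]
    exact fun h => by linarith [h.1, show (τ z : ℝ) < 1 / 3 from hz]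
  · refine hloc.continuousAt.congr ?_
    filter_upwards [(isOpen_lt continuous_const h2).mem_nhds h] with z hz
    have := hξ z
    simp only [Function.comp_apply] at this ⊢
    rw [this, transition_wedge, if_pos]
    exact ⟨by linarith [show 2 / 3 < (τ z : ℝ) from hz], by exact_mod_cast (hτ z).2⟩

end SuspensionPlus

theorem FreeGroup.lift_mk_cons {α G : Type*} [Group G] (φ : α → G) (a : α) (e : Bool)
    (w : List (α × Bool)) :
    FreeGroup.lift φ (.mk ((a, e) :: w)) =
      (cond e (φ a) (φ a)⁻¹) * FreeGroup.lift φ (.mk w) := by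
  simp [FreeGroup.lift_mk]

/-! ### The covering of `Σ(X₊)` with fibre a group generated by the path components -/

/-- Clamping coordinates retracts the plane onto the square, so the square is a quotient of a
Euclidean space. This is what makes homotopies into Σ(X₊) continuous into `Delta X`. -/
instance isGeneratedBy_unitInterval_prod : DeltaGeneratedSpace (I × I) := by
  let f : (Fin 2 → ℝ) → I × I := fun v =>
    (projIcc 0 1 zero_le_one (v 0), projIcc 0 1 zero_le_one (v 1))
  let g : I × I → Fin 2 → ℝ := fun p => ![p.1, p.2]
  have hf : Continuous f := by
    exact (continuous_projIcc.comp (continuous_apply 0)).prodMk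
      (continuous_projIcc.comp (continuous_apply 1))
  have hg : Continuous g := by
    refine continuous_pi fun i => ?_
    fin_cases i
    · exact continuous_subtype_val.comp continuous_fst
    · exact continuous_subtype_val.comp continuous_snd
  have hfg : f ∘ g = id := by
    funext p
    simp [f, g]
  have hq : IsQuotientMap f :=
    .of_comp (g := f) (f := g) hg hf (hfg ▸ IsQuotientMap.id)
  exact hq.isGeneratedBy

namespace SuspensionPlus

variable {X : Type*} [TopologicalSpace X]

/-- `Σ(X₊)` with its topology generated by maps from Euclidean spaces, which has the same paths
and homotopies and is locally path-connected. -/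
abbrev Delta (X : Type*) [TopologicalSpace X] : Type _ :=
  WithGeneratedByTopology (fun n : ℕ => Fin n → ℝ) (SuspensionPlus X)

/-- The identity map `Σ(X₊) → Delta X`. -/
abbrev toDelta : SuspensionPlus X → Delta X :=
  (WithGeneratedByTopology.equiv (X := fun n : ℕ => Fin n → ℝ)).symm

/-- The identity map `Delta X → Σ(X₊)`. -/
abbrev ofDelta : Delta X → SuspensionPlus X :=
  WithGeneratedByTopology.equiv (X := fun n : ℕ => Fin n → ℝ)

theorem continuous_ofDelta : Continuous (ofDelta (X := X)) :=
  WithGeneratedByTopology.continuous_equiv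

theorem continuous_toDelta_comp_prod {f : I × I → SuspensionPlus X} (hf : Continuous f) :
    Continuous (toDelta ∘ f) :=
  (IsGeneratedBy.equiv_symm_comp_continuous_iff (X := fun n : ℕ => Fin n → ℝ) f).2 hf

theorem continuous_toDelta_comp {f : I → SuspensionPlus X} (hf : Continuous f) :
    Continuous (toDelta ∘ f) :=
  (continuous_toDelta_comp_prod (hf.comp continuous_fst)).comp
    (continuous_id.prodMk (continuous_const (y := (0 : I))))

variable {G : Type*} [Group G] [TopologicalSpace G] [DiscreteTopology G]

/-- The two charts of the covering: around the basepoint, and away from it. -/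
def chart (X : Type*) [TopologicalSpace X] : Bool → Set (Delta X)
  | true => ofDelta ⁻¹' offMiddle X
  | false => ofDelta ⁻¹' {base X}ᶜ

/-- The cochain whose coboundary glues the two charts. -/
noncomputable def cochain (φ : ZerothHomotopy X → G) : Bool → Delta X → G
  | true => transition φ ∘ ofDelta
  | false => 1

open Classical in
/-- The covering of `Σ(X₊)` on which `u_x` acts by right multiplication by `φ [x]`. -/
noncomputable def coveringCore (φ : ZerothHomotopy X → G) : FiberBundleCore Bool (Delta X) G :=
  cocycleCore (chart X)
    (by
      rintro (_ | _)
      · exact isOpen_compl_base.preimage continuous_ofDelta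
      · exact isOpen_offMiddle.preimage continuous_ofDelta)
    (fun b => decide (ofDelta b = base X))
    (fun b => by
      by_cases h : ofDelta b = base X
      · simp only [h, decide_true]
        exact mem_preimage.2 (h ▸ base_mem_offMiddle)
      · simp only [h, decide_false]
        exact h)
    (cochain φ)
    (by
      have key : ∀ b : Delta X, ofDelta b ∈ offMiddle X → ofDelta b ≠ base X →
          ContinuousAt (transition φ ∘ ofDelta) b := fun b h h' =>
        continuousAt_transition_comp φ continuous_ofDelta h h'
      rintro (_ | _) (_ | _) b hb
      · simpa [cochain] using continuousWithinAt_const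
      · simpa [cochain, Function.comp_def] using (key b hb.2 hb.1).continuousWithinAt
      · have hinv : Continuous fun g : G => g⁻¹ := continuous_of_discreteTopology
        simpa [cochain, Function.comp_def] using (hinv.continuousAt.comp (key b hb.1 hb.2)).continuousWithinAt
      · simpa [cochain] using continuousWithinAt_const)

/-- The point of the covering over the basepoint labelled by `g`. -/
noncomputable def vertex (φ : ZerothHomotopy X → G) (g : G) : (coveringCore φ).TotalSpace :=
  ⟨toDelta (base X), g⟩

theorem isCoveringMap_proj (φ : ZerothHomotopy X → G) : IsCoveringMap (coveringCore φ).proj :=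
  FiberBundle.isCoveringMap

open Classical in
theorem coordChange_indexAt_base (φ : ZerothHomotopy X → G) {b : Delta X}
    (hb : ofDelta b = base X) (g : G) :
    (coveringCore φ).coordChange ((coveringCore φ).indexAt b) true b g = g := by
  have h : (coveringCore φ).indexAt b = true := decide_eq_true hb
  rw [h]
  change g * (_⁻¹ * _) = g
  simp

open Classical in
theorem coordChange_indexAt_ne_base (φ : ZerothHomotopy X → G) {b : Delta X}
    (hb : ofDelta b ≠ base X) (i : Bool) (g : G) :
    (coveringCore φ).coordChange ((coveringCore φ).indexAt b) i b g = g * cochain φ i b := by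
  have h : (coveringCore φ).indexAt b = false := decide_eq_false hb
  rw [h]
  change g * ((cochain φ false b)⁻¹ * _) = _
  simp [cochain]

/-! ### Lifting words of James loops to the covering -/

theorem exists_lift_jamesLoop (φ : ZerothHomotopy X → G) (x : X) (g : G) :
    ∃ Γ : Path (vertex φ g) (vertex φ (g * φ (.mk x))),
      ∀ t, (coveringCore φ).proj (Γ t) = toDelta (jamesLoop x t) := by
  -- `L` is the fibre coordinate in the preferred chart, which changes at the basepoint. The jump at
  -- t = 1 is exactly the change of chart, so the lift is continuous although `L` need not be.
  obtain ⟨L, hL1, hL⟩ : ∃ L : I → G, L 1 = g * φ (.mk x) ∧ ∀ t, t ≠ 1 → L t = g := by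
    classical
    exact ⟨fun t => if t = 1 then g * φ (.mk x) else g, if_pos rfl, fun t ht => if_neg ht⟩
  have hcont : Continuous fun t : I =>
      (⟨toDelta (wedge x t), L t⟩ : (coveringCore φ).TotalSpace) := by
    refine (coveringCore φ).continuous_of_charts (f := fun t => toDelta (wedge x t))
      (continuous_toDelta_comp (jamesLoop x).continuous) _ ?_
    rintro (_ | _)
    · refine (continuousOn_const (c := g)).congr fun t ht => ?_
      have ht : ofDelta (toDelta (wedge x t)) ≠ base X := ht
      have h1 : t ≠ 1 := by
        rintro rfl
        exact ht (wedge_one x)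
      exact (coordChange_indexAt_ne_base φ ht false (L t)).trans ((mul_one _).trans (hL t h1))
    · have h1 : ∀ t : I, (t : ℝ) < 1 / 3 → (coveringCore φ).coordChange
          ((coveringCore φ).indexAt (toDelta (wedge x t))) true (toDelta (wedge x t))
          (L t) = g := by
        intro t ht
        have h1 : t ≠ 1 := by rintro rfl; norm_num at ht
        rw [hL t h1]
        by_cases hb : ofDelta (toDelta (wedge x t)) = base X
        · exact coordChange_indexAt_base φ hb g
        · rw [coordChange_indexAt_ne_base φ hb]
          change g * transition φ (wedge x t) = g
          rw [transition_wedge, if_neg (fun h => by linarith [h.1]), mul_one]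
      have h2 : ∀ t : I, 2 / 3 < (t : ℝ) → (coveringCore φ).coordChange
          ((coveringCore φ).indexAt (toDelta (wedge x t))) true (toDelta (wedge x t))
          (L t) = g * φ (.mk x) := by
        intro t ht
        by_cases h1 : t = 1
        · rw [h1, hL1]
          exact coordChange_indexAt_base φ (wedge_one x) _
        · have h0 : t ≠ 0 := by rintro rfl; norm_num at ht
          have hb : ofDelta (toDelta (wedge x t)) ≠ base X := fun h =>
            (wedge_eq_base.1 h).elim h0 h1
          rw [hL t h1, coordChange_indexAt_ne_base φ hb]
          change g * transition φ (wedge x t) = _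
          rw [transition_wedge, if_pos ⟨by linarith, by exact_mod_cast unitInterval.lt_one_iff_ne_one.2 h1⟩]
      intro t ht
      refine ContinuousAt.continuousWithinAt ?_
      have hcoe : Continuous fun t : I => (t : ℝ) := continuous_subtype_val
      rcases wedge_mem_offMiddle.1 ht with h | h
      · refine (continuousAt_const (y := g)).congr ?_
        filter_upwards [(isOpen_lt hcoe continuous_const).mem_nhds h] with s hs
        exact (h1 s hs).symm
      · refine (continuousAt_const (y := g * φ (.mk x))).congr ?_
        filter_upwards [(isOpen_lt continuous_const hcoe).mem_nhds h] with s hs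
        exact (h2 s hs).symm
  refine ⟨⟨⟨_, hcont⟩, ?_, ?_⟩, fun t => rfl⟩
  · change (⟨toDelta (wedge x 0), _⟩ : (coveringCore φ).TotalSpace) = _
    rw [wedge_zero, hL 0 zero_ne_one, vertex]
  · change (⟨toDelta (wedge x 1), _⟩ : (coveringCore φ).TotalSpace) = _
    rw [wedge_one, hL1, vertex]

theorem exists_lift_trans (φ : ZerothHomotopy X → G) {α β : Path (base X) (base X)} {g h k : G}
    (hα : ∃ Γ : Path (vertex φ g) (vertex φ h),
      ∀ t, (coveringCore φ).proj (Γ t) = toDelta (α t))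
    (hβ : ∃ Γ : Path (vertex φ h) (vertex φ k),
      ∀ t, (coveringCore φ).proj (Γ t) = toDelta (β t)) :
    ∃ Γ : Path (vertex φ g) (vertex φ k),
      ∀ t, (coveringCore φ).proj (Γ t) = toDelta (α.trans β t) := by
  obtain ⟨Γ, hΓ⟩ := hα
  obtain ⟨Δ, hΔ⟩ := hβ
  refine ⟨Γ.trans Δ, fun t => ?_⟩
  rw [Path.trans_apply, Path.trans_apply]
  split_ifs
  · exact hΓ _
  · exact hΔ _

theorem exists_lift_jamesWord (φ : ZerothHomotopy X → G) (w : List (X × Bool)) (g : G) :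
    ∃ Γ : Path (vertex φ g) (vertex φ
        (g * FreeGroup.lift φ (.mk (w.map fun a => (ZerothHomotopy.mk a.1, a.2))))),
      ∀ t, (coveringCore φ).proj (Γ t) = toDelta (jamesWord w t) := by
  induction w generalizing g with
  | nil =>
    rw [List.map_nil, ← FreeGroup.one_eq_mk, map_one, mul_one]
    exact ⟨Path.refl _, fun t => rfl⟩
  | cons a w ih =>
    obtain ⟨x, e⟩ := a
    have hcons := FreeGroup.lift_mk_cons φ (.mk x) e
      (w.map fun a => (ZerothHomotopy.mk a.1, a.2))
    obtain _ | _ := e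
    · have h := ih (g * (φ (.mk x))⁻¹)
      rw [mul_assoc] at h
      rw [List.map_cons, hcons]
      refine exists_lift_trans φ ?_ h
      -- A reversed loop is lifted from `g` by reversing the lift that ends at `g`.
      have hx := exists_lift_jamesLoop φ x (g * (φ (.mk x))⁻¹)
      rw [inv_mul_cancel_right] at hx
      obtain ⟨Γ, hΓ⟩ := hx
      exact ⟨Γ.symm, fun t => hΓ _⟩
    · have h := ih (g * φ (.mk x))
      rw [mul_assoc] at h
      rw [List.map_cons, hcons]
      exact exists_lift_trans φ (exists_lift_jamesLoop φ x g) h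

theorem lift_eq_one_of_homotopic_refl (φ : ZerothHomotopy X → G) (w : List (X × Bool))
    (h : (jamesWord w).Homotopic (Path.refl _)) :
    FreeGroup.lift φ (.mk (w.map fun a => (ZerothHomotopy.mk a.1, a.2))) = 1 := by
  obtain ⟨Γ, hΓ⟩ := exists_lift_jamesWord φ w 1
  obtain ⟨F⟩ := h
  -- The null-homotopy lifts relative to the endpoints, so `Γ` ends where the constant path at
  -- `vertex φ 1` does.
  have hrel := ((isCoveringMap_proj φ).homotopicRel_iff_comp (S := {0, 1})
    (f₀ := Γ.toContinuousMap) (f₁ := (Path.refl (vertex φ 1)).toContinuousMap)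
    ⟨0, Or.inl rfl, Γ.source⟩).2 ⟨{
      toFun := toDelta ∘ F
      continuous_toFun := continuous_toDelta_comp_prod F.continuous
      map_zero_left := fun t => (congrArg toDelta (F.map_zero_left t)).trans (hΓ t).symm
      map_one_left := fun t => congrArg toDelta (F.map_one_left t)
      prop' := fun s t ht => (congrArg toDelta (F.prop' s t ht)).trans (hΓ t).symm }⟩
  obtain ⟨H⟩ := hrel
  have h1 := (H.eq_fst 1 (x := 1) (Or.inr rfl)).symm.trans (H.map_one_left 1)
  have h2 := Γ.target.symm.trans h1
  rw [one_mul] at h2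
  injection h2

end SuspensionPlus

/-! ### Loops in `Σ(X₊)` are homotopic to words of James loops -/

/-- The boundary of a square commutes up to homotopy. -/
theorem Path.homotopic_of_square {Y : Type*} [TopologicalSpace Y] (S : C(I × I, Y))
    {a b c d : Y} {p : Path a b} {q : Path b d} {p' : Path a c} {q' : Path c d}
    (hp : ∀ t, S (t, 0) = p t) (hq : ∀ t, S (1, t) = q t)
    (hp' : ∀ t, S (0, t) = p' t) (hq' : ∀ t, S (t, 1) = q' t) :
    (p.trans q).Homotopic (p'.trans q') := by
  let e : Path (0 : I) 1 := ⟨ContinuousMap.id I, rfl, rfl⟩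
  have : ContractibleSpace I :=
    (convex_Icc (0 : ℝ) 1).contractibleSpace ⟨0, left_mem_Icc.2 zero_le_one⟩
  have h := (SimplyConnectedSpace.paths_homotopic
    ((e.prod (Path.refl (0 : I))).trans ((Path.refl (1 : I)).prod e))
    (((Path.refl (0 : I)).prod e).trans (e.prod (Path.refl (1 : I))))).map S
  rw [Path.map_trans, Path.map_trans] at h
  obtain rfl : S (0, 0) = a := (hp 0).trans p.source
  obtain rfl : S (1, 0) = b := (hp 1).trans p.target
  obtain rfl : S (0, 1) = c := (hp' 1).trans p'.target
  obtain rfl : S (1, 1) = d := (hq 1).trans q.target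
  convert h using 2
  · ext t; exact (hp t).symm
  · ext t; exact (hq t).symm
  · ext t; exact (hp' t).symm
  · ext t; exact (hq' t).symm

theorem loopClass_refl {Y : Type*} [TopologicalSpace Y] (y : Y) :
    loopClass (Path.refl y) = 1 := rfl

theorem loopClass_symm {Y : Type*} [TopologicalSpace Y] {y : Y} (α : Path y y) :
    loopClass α.symm = (loopClass α)⁻¹ := rfl

namespace SuspensionPlus

variable {X : Type*} [TopologicalSpace X]

/-- The initial part of the James loop `u_x`, from the basepoint to `x ∧ t`. -/
def arc (x : X) (t : I) : Path (base X) (wedge x t) where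
  toFun s := wedge x (s * t)
  continuous_toFun := continuous_wedge.comp
    (by fun_prop : Continuous fun s : I => (x, s * t))
  source' := by rw [zero_mul, wedge_zero]
  target' := by rw [one_mul]

theorem jamesHom_of (x : X) :
    jamesHom X (FreeGroup.of (ZerothHomotopy.mk x)) = loopClass (jamesLoop x) :=
  FreeGroup.lift_apply_of

/-- Such an arc has t = 0 or t = 1, so it is constant or a full James loop. -/
theorem loopClass_arc_mem_range {x : X} {t : I} (h : wedge x t = base X) :
    loopClass ((arc x t).cast rfl h.symm) ∈ (jamesHom X).range := by
  obtain rfl | rfl := wedge_eq_base.1 h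
  · have : (arc x 0).cast rfl h.symm = Path.refl _ := by
      ext s
      change wedge x (s * 0) = base X
      rw [mul_zero, wedge_zero]
    rw [this, loopClass_refl]
    exact one_mem _
  · have : (arc x 1).cast rfl h.symm = jamesLoop x := by
      ext s
      change wedge x (s * 1) = wedge x s
      rw [mul_one]
    rw [this, ← jamesHom_of]
    exact ⟨_, rfl⟩

/-- A path starting at the basepoint, closed up along an arc of a James loop, has its class in
the range of `h_X`. -/
def ClosesUp {b : SuspensionPlus X} (δ : Path (base X) b) : Prop :=
  ∀ (x : X) (t : I) (h : wedge x t = b),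
    loopClass ((δ.cast rfl h).trans (arc x t).symm) ∈ (jamesHom X).range

theorem ClosesUp.congr {b : SuspensionPlus X} {δ δ' : Path (base X) b} (hδ : ClosesUp δ)
    (h : δ.Homotopic δ') : ClosesUp δ' := by
  rintro x t rfl
  have := hδ x t rfl
  rwa [show loopClass ((δ.cast rfl rfl).trans (arc x t).symm) =
    loopClass ((δ'.cast rfl rfl).trans (arc x t).symm) from
    loopClass_eq_iff.2 (h.hcomp (.refl (arc x t).symm))] at this

theorem loopClass_closeUp_mem_iff (δ : Path (base X) (base X)) {x : X} {t : I}
    (h : wedge x t = base X) :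
    loopClass ((δ.cast rfl h).trans (arc x t).symm) ∈ (jamesHom X).range ↔
      loopClass δ ∈ (jamesHom X).range := by
  have : (δ.cast rfl h).trans (arc x t).symm = δ.trans ((arc x t).cast rfl h.symm).symm := rfl
  rw [this, loopClass_trans, loopClass_symm]
  exact Subgroup.mul_mem_cancel_right _ (inv_mem (loopClass_arc_mem_range h))

theorem closesUp_loop_iff [Nonempty X] {b : SuspensionPlus X} (δ : Path (base X) b)
    (hb : b = base X) :
    ClosesUp δ ↔ loopClass (δ.cast rfl hb.symm) ∈ (jamesHom X).range := by
  subst hb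
  refine ⟨fun h => ?_, fun h x t hx => (loopClass_closeUp_mem_iff δ hx).2 h⟩
  have hx := wedge_zero (Classical.arbitrary X)
  exact (loopClass_closeUp_mem_iff δ hx).1 (h _ _ hx)

/-- One closing arc suffices: off the basepoint the coordinates are unique, and at the basepoint two
choices differ by elements of the range. -/
theorem closesUp_of_mem {x : X} {t : I} {δ : Path (base X) (wedge x t)}
    (h : loopClass (δ.trans (arc x t).symm) ∈ (jamesHom X).range) : ClosesUp δ := by
  intro y s hy
  obtain ⟨rfl, rfl⟩ | ⟨-, ht⟩ := wedge_eq_wedge.1 hy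
  · exact h
  · have := Nonempty.intro x
    have hb : wedge x t = base X := wedge_eq_base.2 ht
    exact (closesUp_loop_iff δ hb).2 ((loopClass_closeUp_mem_iff (δ.cast rfl hb.symm) hb).1 h) _ _ hy

theorem ClosesUp.trans_cylinder {b b' : SuspensionPlus X} {δ : Path (base X) b} (hδ : ClosesUp δ)
    (γ : Path b b') (ξ : C(I, X)) (τ : C(I, I)) (h : ∀ s, γ s = wedge (ξ s) (τ s)) :
    ClosesUp (δ.trans γ) := by
  obtain rfl : wedge (ξ 0) (τ 0) = b := (h 0).symm.trans γ.source
  obtain rfl : wedge (ξ 1) (τ 1) = b' := (h 1).symm.trans γ.target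
  -- The arcs to the points of `γ` sweep out a square whose edge s = 0 collapses to the basepoint.
  -- Nothing requires `τ` to stay inside (0,1), so `γ` may cross the basepoint.
  have hsq : ((arc (ξ 0) (τ 0)).trans γ).Homotopic
      ((Path.refl _).trans (arc (ξ 1) (τ 1))) :=
    Path.homotopic_of_square
      ⟨fun p => wedge (ξ p.2) (p.1 * τ p.2), continuous_wedge.comp
        (by fun_prop : Continuous fun p : I × I => (ξ p.2, p.1 * τ p.2))⟩
      (fun t => rfl)
      (fun t => by
        change wedge (ξ t) (1 * τ t) = γ t
        rw [one_mul, h])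
      (fun t => by
        change wedge (ξ t) (0 * τ t) = base X
        rw [zero_mul, wedge_zero])
      (fun t => rfl)
  have hhom : (δ.trans (arc (ξ 0) (τ 0)).symm).Homotopic
      ((δ.trans γ).trans (arc (ξ 1) (τ 1)).symm) := by
    rw [← Path.Homotopic.Quotient.eq] at hsq ⊢
    simp only [Path.Homotopic.Quotient.mk_trans, Path.Homotopic.Quotient.mk_symm,
      Path.Homotopic.Quotient.mk_refl, Path.Homotopic.Quotient.refl_trans] at hsq ⊢
    have hγ : Path.Homotopic.Quotient.mk γ =
        (Path.Homotopic.Quotient.mk (arc (ξ 0) (τ 0))).symm.trans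
          (Path.Homotopic.Quotient.mk (arc (ξ 1) (τ 1))) := by
      rw [← hsq, ← Path.Homotopic.Quotient.trans_assoc, Path.Homotopic.Quotient.symm_trans,
        Path.Homotopic.Quotient.refl_trans]
    rw [hγ, Path.Homotopic.Quotient.trans_assoc, Path.Homotopic.Quotient.trans_assoc,
      Path.Homotopic.Quotient.trans_symm, Path.Homotopic.Quotient.trans_refl]
  exact closesUp_of_mem (loopClass_eq_iff.2 hhom ▸ hδ _ _ rfl)

theorem ClosesUp.trans_const {b b' : SuspensionPlus X} {δ : Path (base X) b} (hδ : ClosesUp δ)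
    (γ : Path b b') (h : ∀ s, γ s = base X) : ClosesUp (δ.trans γ) := by
  obtain rfl : base X = b := (h 0).symm.trans γ.source
  obtain rfl : base X = b' := (h 1).symm.trans γ.target
  obtain rfl : γ = Path.refl _ := by ext s; exact h s
  exact hδ.congr ⟨(Path.Homotopy.transRefl δ).symm⟩

/-! ### Stretching the cylinder and subdividing loops -/

/-- The map of `Σ(X₊)` induced by `ψ : I → I` preserving the endpoints. -/
def reparam (ψ : I → I) (h0 : ψ 0 = 0) (h1 : ψ 1 = 1) : SuspensionPlus X → SuspensionPlus X :=
  Quotient.map (fun p => (p.1, ψ p.2)) (by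
    rintro p q (rfl | ⟨hp, hq⟩)
    · exact Or.inl rfl
    · refine Or.inr ⟨?_, ?_⟩
      · rcases hp with h | h | h
        · exact Or.inl (by rw [h, h0])
        · exact Or.inr (Or.inl (by rw [h, h1]))
        · exact Or.inr (Or.inr h)
      · rcases hq with h | h | h
        · exact Or.inl (by rw [h, h0])
        · exact Or.inr (Or.inl (by rw [h, h1]))
        · exact Or.inr (Or.inr h))

/-- The linear homotopy from the identity of `I` to the map that collapses `[0,1/3]` to `0` and
`[2/3,1]` to `1`. -/
noncomputable def stretch (s t : I) : I :=
  projIcc 0 1 zero_le_one ((t : ℝ) + s * (2 * t - 1))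

theorem stretch_of_le {s t : I} (h : (t : ℝ) + s * (2 * t - 1) ≤ 0) : stretch s t = 0 :=
  projIcc_of_le_left _ h

theorem stretch_of_ge {s t : I} (h : 1 ≤ (t : ℝ) + s * (2 * t - 1)) : stretch s t = 1 :=
  projIcc_of_right_le _ h

theorem stretch_zero_right (s : I) : stretch s 0 = 0 :=
  stretch_of_le (by norm_num; exact s.2.1)

theorem stretch_one_right (s : I) : stretch s 1 = 1 :=
  stretch_of_ge (by norm_num; exact s.2.1)

theorem stretch_zero_left (t : I) : stretch 0 t = t := by
  simp [stretch]

theorem continuous_stretch : Continuous fun p : I × I => stretch p.1 p.2 :=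
  continuous_projIcc.comp (by fun_prop)

/-- The self-map of `Σ(X₊)` stretching the cylinder coordinate. -/
noncomputable def stretchMap (s : I) : SuspensionPlus X → SuspensionPlus X :=
  reparam (stretch s) (stretch_zero_right s) (stretch_one_right s)

theorem stretchMap_wedge {X : Type*} (s : I) (x : X) (t : I) :
    stretchMap s (wedge x t) = wedge x (stretch s t) := rfl

theorem stretchMap_base {X : Type*} (s : I) : stretchMap s (base X) = base X := mk_inr _

theorem stretchMap_zero {X : Type*} (b : SuspensionPlus X) : stretchMap 0 b = b := by
  obtain rfl | ⟨x, t, rfl⟩ := eq_base_or_wedge b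
  · exact stretchMap_base 0
  · rw [stretchMap_wedge, stretch_zero_left]

theorem stretchMap_one_of_mem_offMiddle {X : Type*} {b : SuspensionPlus X}
    (hb : b ∈ offMiddle X) : stretchMap 1 b = base X := by
  obtain rfl | ⟨x, t, rfl⟩ := eq_base_or_wedge b
  · exact stretchMap_base 1
  · rw [stretchMap_wedge, wedge_eq_base]
    rcases wedge_mem_offMiddle.1 hb with h | h
    -- At s = 1 the unclamped coordinate is 3t - 1, which is at most 0 for t ≤ 1/3 and at least 1
    -- for t ≥ 2/3.
    · exact Or.inl (stretch_of_le (by norm_num; linarith))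
    · exact Or.inr (stretch_of_ge (by norm_num; linarith))

/-- The product of the locally compact `I` with a quotient map is again a quotient map, so
continuity is checked on I × X × I. -/
theorem continuous_stretchMap [Nonempty X] :
    Continuous fun p : I × SuspensionPlus X => stretchMap p.1 p.2 :=
  isQuotientMap_wedge.continuous_lift_prod_right
    (continuous_wedge.comp ((continuous_fst.comp continuous_snd).prodMk
      (continuous_stretch.comp (by fun_prop : Continuous fun p : I × X × I => (p.1, p.2.2)))))

theorem exists_homotopic_stretch [Nonempty X] (α : Path (base X) (base X)) :
    ∃ β : Path (base X) (base X), α.Homotopic β ∧ ∀ t, β t = stretchMap 1 (α t) := by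
  refine ⟨⟨⟨fun t => stretchMap 1 (α t), ?_⟩, ?_, ?_⟩, ⟨⟨⟨⟨fun p => stretchMap p.1 (α p.2), ?_⟩,
    fun t => ?_, fun t => rfl⟩, ?_⟩⟩, fun t => rfl⟩
  · exact continuous_stretchMap.comp (continuous_const.prodMk α.continuous)
  · simp [stretchMap_base]
  · simp [stretchMap_base]
  · exact continuous_stretchMap.comp (continuous_fst.prodMk (α.continuous.comp continuous_snd))
  · exact stretchMap_zero _
  · rintro s t (rfl | rfl)
    · simp [stretchMap_base]
    · simp [stretchMap_base]

theorem loopClass_mem_range [Nonempty X] (α : Path (base X) (base X)) :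
    loopClass α ∈ (jamesHom X).range := by
  obtain ⟨β, hβ, hβα⟩ := exists_homotopic_stretch α
  rw [loopClass_eq_iff.2 hβ]
  -- The cover is pulled back along the original `α`, not `β`: coordinates exist where `α` avoids
  -- the basepoint, and `β` is constant where `α` stays in `offMiddle X`.
  obtain ⟨t, ht0, htm, ⟨N, hN⟩, ht⟩ := exists_monotone_Icc_subset_open_cover_unitInterval
    (c := fun i : Bool => cond i (α ⁻¹' offMiddle X) (α ⁻¹' {base X}ᶜ))
    (by
      rintro (_ | _)
      · exact isOpen_compl_base.preimage α.continuous
      · exact isOpen_offMiddle.preimage α.continuous)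
    (by
      intro s _
      rw [mem_iUnion]
      by_cases h : α s = base X
      · refine ⟨true, ?_⟩
        change α s ∈ offMiddle X
        rw [h]
        exact base_mem_offMiddle
      · exact ⟨false, h⟩)
  have hβ0 : base X = β 0 := β.source.symm
  have key : ∀ n, ClosesUp ((β.subpath 0 (t n)).cast hβ0 rfl) := by
    intro n
    induction n with
    | zero =>
      -- The endpoint is generalized because `t 0` occurs in the type of the path and cannot simply
      -- be rewritten to 0.
      have : ∀ s, s = 0 → ClosesUp ((β.subpath 0 s).cast hβ0 rfl) := by
        rintro _ rfl
        rw [closesUp_loop_iff _ β.source, Path.subpath_self]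
        have : ((Path.refl (β 0)).cast hβ0 rfl).cast rfl β.source.symm = Path.refl _ := by
          ext s; exact β.source
        rw [this, loopClass_refl]
        exact one_mem _
      exact this _ ht0
    | succ n ih =>
      have hh : (((β.subpath 0 (t n)).cast hβ0 rfl).trans
          (β.subpath (t n) (t (n + 1)))).Homotopic ((β.subpath 0 (t (n + 1))).cast hβ0 rfl) := by
        have h : ∀ {a b c d : SuspensionPlus X} (h : d = a) (p : Path a b) (q : Path b c)
            (r : Path a c), (p.trans q).Homotopic r →
            ((p.cast h rfl).trans q).Homotopic (r.cast h rfl) := by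
          rintro a b c d rfl p q r h
          exact h
        exact h _ _ _ _ ⟨Path.Homotopy.subpathTransSubpath β 0 (t n) (t (n + 1))⟩
      refine ClosesUp.congr ?_ hh
      have hsub (s : I) : Icc.convexComb (t n) (t (n + 1)) s ∈ Icc (t n) (t (n + 1)) := by
        rw [← uIcc_of_le (htm n.le_succ), ← Path.range_subpathAux]
        exact mem_range_self s
      obtain ⟨_ | _, hi⟩ := ht n
      · obtain ⟨ξ, τ, -, hξ⟩ := exists_coordinates
          (f := fun s => α (Icc.convexComb (t n) (t (n + 1)) s)) (α.subpath (t n) (t (n + 1))).continuous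
          fun s => hi (hsub s)
        refine ih.trans_cylinder _ ξ ⟨fun s => stretch 1 (τ s),
          continuous_stretch.comp (by fun_prop : Continuous fun s => ((1 : I), τ s))⟩ fun s => ?_
        exact (hβα _).trans (congrArg (stretchMap 1) (hξ s))
      · exact ih.trans_const _ fun s =>
          (hβα _).trans (stretchMap_one_of_mem_offMiddle (hi (hsub s)))
  have hfin : ∀ s, s = 1 → ClosesUp ((β.subpath 0 s).cast hβ0 rfl) →
      loopClass β ∈ (jamesHom X).range := by
    rintro _ rfl h
    rw [closesUp_loop_iff _ β.target, Path.subpath_zero_one] at h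
    exact h
  exact hfin _ (hN N le_rfl) (key N)

/-! ### Words, injectivity and surjectivity -/

theorem jamesHom_mk (w : List (X × Bool)) :
    jamesHom X (FreeGroup.mk (w.map fun a => (ZerothHomotopy.mk a.1, a.2))) =
      loopClass (jamesWord w) := by
  induction w with
  | nil => rfl
  | cons a w ih =>
    obtain ⟨x, e⟩ := a
    refine (FreeGroup.lift_mk_cons (jamesClass X) (.mk x) e _).trans ?_
    obtain _ | _ := e
    · exact congrArg ((loopClass (jamesLoop x))⁻¹ * ·) ih
    · exact congrArg (loopClass (jamesLoop x) * ·) ih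

theorem jamesHom_injective : Function.Injective (jamesHom X) := by
  refine (injective_iff_map_eq_one _).2 fun g hg => ?_
  -- Choosing a point in each path component turns a word in components into a word in points of
  -- `X`.
  obtain ⟨w, rfl⟩ : ∃ w : List (X × Bool),
      FreeGroup.mk (w.map fun a => (ZerothHomotopy.mk a.1, a.2)) = g := by
    obtain ⟨w, rfl⟩ := Quot.exists_rep g
    obtain ⟨v, hv⟩ := (List.map_surjective_iff.2
      (ZerothHomotopy.mk_surjective.prodMap Function.surjective_id)) w
    exact ⟨v, congrArg FreeGroup.mk hv⟩
  rw [jamesHom_mk, ← loopClass_refl, loopClass_eq_iff] at hg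
  let _ : TopologicalSpace (FreeGroup (ZerothHomotopy X)) := ⊥
  have : DiscreteTopology (FreeGroup (ZerothHomotopy X)) := ⟨rfl⟩
  have := lift_eq_one_of_homotopic_refl FreeGroup.of w hg
  rwa [FreeGroup.lift_of_eq_id, MonoidHom.id_apply] at this

theorem jamesHom_surjective : Function.Surjective (jamesHom X) := by
  intro c
  obtain ⟨α, hα⟩ := Path.Homotopic.Quotient.mk_surjective c.unop
  obtain rfl : loopClass α = c := congrArg MulOpposite.op hα
  -- For empty `X` the suspension is a single point, and X × I does not surject onto it, so the
  -- quotient argument needs `X` nonempty.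
  cases isEmpty_or_nonempty X
  · have hb (b : SuspensionPlus X) : b = base X :=
      (eq_base_or_wedge b).resolve_right fun ⟨x, _⟩ => isEmptyElim x
    obtain rfl : α = Path.refl _ := by ext s; exact hb _
    exact ⟨1, map_one _⟩
  · exact loopClass_mem_range α

end SuspensionPlus

theorem mainTheorem2 (X : Type*) [TopologicalSpace X] :
    (∀ x y : X, Joined x y → loopClass (jamesLoop x) = loopClass (jamesLoop y)) ∧
    (∀ x : X, jamesHom X (FreeGroup.of (ZerothHomotopy.mk x)) = loopClass (jamesLoop x)) ∧
    (∀ w : List (X × Bool),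
      jamesHom X (FreeGroup.mk (w.map fun a => (ZerothHomotopy.mk a.1, a.2))) =
        loopClass (jamesWord w)) ∧
    Function.Bijective (jamesHom X) :=
  ⟨fun _ _ h => loopClass_eq_iff.2 (jamesLoop_homotopic h), SuspensionPlus.jamesHom_of,
    SuspensionPlus.jamesHom_mk, SuspensionPlus.jamesHom_injective,
    SuspensionPlus.jamesHom_surjective⟩
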